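/- Let $\mathbb{K}$ be a field, $V=\{1<\dots<n\}$ a finite vertex set, and $\Delta$ a $d$-dimensional simplicial complex on $V$ (the empty set is a face, and $d=\max\{|\sigma|-1:\sigma\in\Delta\}$; not every element of $V$ has to be a vertex of $\Delta$). Let $R=\mathbb{K}[x_1,\dots,x_n]$ act on $S=\mathbb{K}[y_1,\dots,y_n]$ by contraction: $x^a\circ y^b=y^{b-a}$ if $b_i\ge a_i$ for all $i$, and $x^a\circ y^b=0$ otherwise, extended bilinearly. Let $I_\Delta=(\prod_{i\in\tau}x_i:\tau\subseteq V,\ \tau\notin\Delta)$ be the Stanley–Reisner ideal and $e_i$ the $i$-th elementary symmetric polynomial in $x_1,\dots,x_n$. For $k\ge 0$ let the space of $k$-coinvariant stresses be $$\mathcal{S}^{\mathrm{co}}_k(\Delta)=\{F\in S:\ F \text{ homogeneous of degree } k \text{ in the } y_i,\ g\circ F=0 \text{ for all } g\in(I_\Delta,e_1,\dots,e_{d+1})\}.$$ Put $t=\binom{d+2}{2}$. Then $$\dim_{\mathbb{K}}\mathcal{S}^{\mathrm{co}}_t(\Delta)\ \ge\ \dim_{\mathbb{K}}\tilde H_d(\Delta;\mathbb{K}),$$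 where $\tilde H_d$ denotes reduced simplicial homology. Moreover, if $\mathbb{K}$ has characteristic zero and $\Delta$ is Cohen–Macaulay over $\mathbb{K}$ (that is, $R/I_\Delta$ is a Cohen–Macaulay ring), then equality holds: $$\dim_{\mathbb{K}}\mathcal{S}^{\mathrm{co}}_t(\Delta)=\dim_{\mathbb{K}}\tilde H_d(\Delta;\mathbb{K}).$$ -/

import Mathlib

/-- A commutative ring `A` is Cohen–Macaulay if it is Noetherian and, for every maximal ideal `m`,
the local ring `A_m` has depth equal to its Krull dimension, i.e. its maximal ideal contains an
`A_m`-regular sequence whose length is `dim A_m` (no regular sequence can be longer). -/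
def IsCohenMacaulayRing (A : Type*) [CommRing A] : Prop :=
  IsNoetherianRing A ∧
    ∀ (m : Ideal A) [m.IsMaximal], ∃ rs : List (Localization.AtPrime m),
      (∀ r ∈ rs, r ∈ IsLocalRing.maximalIdeal (Localization.AtPrime m)) ∧
      RingTheory.Sequence.IsRegular (Localization.AtPrime m) rs ∧
      ((rs.length : ℕ∞) : WithBot ℕ∞) = ringKrullDim (Localization.AtPrime m)

section InverseSystems

variable (K V : Type*) [Field K]

/-- The contraction action of `R = K[x_v : v ∈ V]` on `S = K[y_v : v ∈ V]` (a second copy of the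
same polynomial ring): `x^a ∘ y^b = y^(b - a)` if `a ≤ b` coordinatewise and `x^a ∘ y^b = 0`
otherwise, extended bilinearly. -/
noncomputable def contraction :
    MvPolynomial V K →ₗ[K] MvPolynomial V K →ₗ[K] MvPolynomial V K := by
  classical
  exact (MvPolynomial.basisMonomials V K).constr K fun a =>
    (MvPolynomial.basisMonomials V K).constr K fun b =>
      if a ≤ b then MvPolynomial.monomial (b - a) (1 : K) else 0

variable {K V}

/-- The inverse system `I⁻¹ = {F ∈ S : g ∘ F = 0 for every g ∈ I}`, as a `K`-vector space. -/
noncomputable def inverseSystem (I : Ideal (MvPolynomial V K)) :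
    Submodule K (MvPolynomial V K) where
  carrier := {F | ∀ g ∈ I, contraction K V g F = 0}
  add_mem' := by
    intro F G hF hG g hg
    rw [map_add, hF g hg, hG g hg, add_zero]
  zero_mem' := by
    intro g _
    exact map_zero _
  smul_mem' := by
    intro c F hF g hg
    rw [map_smul, hF g hg, smul_zero]

/-- The component `(I⁻¹)_{-k}`. Since `deg y_v = -1`, it consists of the elements of `I⁻¹` that
are homogeneous polynomials of ordinary degree `k`. -/
noncomputable def inverseSystemDegree (I : Ideal (MvPolynomial V K)) (k : ℕ) :
    Submodule K (MvPolynomial V K) :=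
  inverseSystem I ⊓ MvPolynomial.homogeneousSubmodule V K k

end InverseSystems

namespace PreAbstractSimplicialComplex

/-- The faces of a simplicial complex, the empty face included. (Mathlib's `Δ.faces` lists the
nonempty ones.) -/
def IsFace {V : Type*} (Δ : PreAbstractSimplicialComplex V) (σ : Finset V) : Prop :=
  σ = ∅ ∨ σ ∈ Δ.faces

open Classical in
/-- `dim Δ`: the maximum of `|σ| - 1` over the faces `σ`; it is `-1` for the complex `{∅}`. -/
noncomputable def dim {V : Type*} [Fintype V] (Δ : PreAbstractSimplicialComplex V) : ℤ :=
  (((Finset.univ.filter fun σ : Finset V => Δ.IsFace σ).sup Finset.card : ℕ) : ℤ) - 1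

section Homology

variable (K : Type*) [Field K] {V : Type*} [Fintype V] [LinearOrder V]

/-- The simplicial boundary map
`∂ {v_0 < ⋯ < v_i} = ∑ j, (-1)^j {v_0, …, v_i} \ {v_j}` on the vector space `Finset V → K` with
basis (`Pi.single σ 1`) all subsets `σ` of `V`. Here `j` is the number of elements of the set
below `v_j`. In particular `∂ {v} = ∅` (the augmentation) and `∂ ∅ = 0`. -/
noncomputable def boundary : (Finset V → K) →ₗ[K] (Finset V → K) :=
  Fintype.linearCombination K fun σ : Finset V =>
    ∑ v ∈ σ, Pi.single (σ.erase v) ((-1 : K) ^ (σ.filter (· < v)).card)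

/-- The chain group `C_i(Δ; K)`, with basis the `i`-dimensional faces; `C_{-1}` is spanned
by `∅`. -/
def chains (Δ : PreAbstractSimplicialComplex V) (i : ℤ) : Submodule K (Finset V → K) where
  carrier := {c | ∀ σ : Finset V, c σ ≠ 0 → Δ.IsFace σ ∧ (σ.card : ℤ) - 1 = i}
  add_mem' := by
    intro a b ha hb σ h
    by_cases h0 : a σ = 0
    · exact hb σ fun h1 => h (by simp [h0, h1])
    · exact ha σ h0
  zero_mem' := by
    intro σ h
    exact absurd rfl h
  smul_mem' := by
    intro c a ha σ h
    exact ha σ fun h0 => h (by simp [h0])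

/-- The reduced cycles of dimension `i`. -/
noncomputable def cycles (Δ : PreAbstractSimplicialComplex V) (i : ℤ) :
    Submodule K (Finset V → K) :=
  Δ.chains K i ⊓ LinearMap.ker (boundary K)

/-- The boundaries of dimension `i`. -/
noncomputable def boundaries (Δ : PreAbstractSimplicialComplex V) (i : ℤ) :
    Submodule K (Finset V → K) :=
  (Δ.chains K (i + 1)).map (boundary K)

/-- The reduced simplicial homology `H̃_i(Δ; K)`: cycles modulo boundaries. -/
abbrev reducedHomology (Δ : PreAbstractSimplicialComplex V) (i : ℤ) : Type _ :=
  Δ.cycles K i ⧸ (Δ.boundaries K i).submoduleOf (Δ.cycles K i)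

end Homology

section StanleyReisner

variable (K : Type*) [Field K] {V : Type*}

/-- The Stanley–Reisner ideal `I_Δ = (∏_{v ∈ τ} x_v : τ ∉ Δ)`. -/
noncomputable def stanleyReisnerIdeal (Δ : PreAbstractSimplicialComplex V) : Ideal (MvPolynomial V K) :=
  Ideal.span {p | ∃ τ : Finset V, ¬ Δ.IsFace τ ∧ p = ∏ v ∈ τ, MvPolynomial.X v}

/-- `Δ` is Cohen–Macaulay over `K` if its Stanley–Reisner ring `R / I_Δ` is Cohen–Macaulay. -/
def IsCohenMacaulay (Δ : PreAbstractSimplicialComplex V) : Prop :=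
  IsCohenMacaulayRing (MvPolynomial V K ⧸ Δ.stanleyReisnerIdeal K)

variable [Fintype V]

/-- The ideal `(I_Δ, e_1, …, e_{d+1})`, where `d = dim Δ` and `e_i` is the `i`-th elementary
symmetric polynomial in all the variables. -/
noncomputable def coinvariantIdeal (Δ : PreAbstractSimplicialComplex V) :
    Ideal (MvPolynomial V K) :=
  Δ.stanleyReisnerIdeal K ⊔
    Ideal.span {p | ∃ i : ℕ, 1 ≤ i ∧ (i : ℤ) ≤ Δ.dim + 1 ∧ p = MvPolynomial.esymm V K i}

/-- The space `S^co_k(Δ) = (I_Δ, e_1, …, e_{d+1})⁻¹_{-k}` of `k`-coinvariant stresses. -/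
noncomputable def coinvariantStresses (Δ : PreAbstractSimplicialComplex V) (k : ℕ) :
    Submodule K (MvPolynomial V K) :=
  inverseSystemDegree (Δ.coinvariantIdeal K) k

end StanleyReisner

end PreAbstractSimplicialComplex

/-! Put `D = d + 1`. A chain `c` on the sets of cardinality `D` defines the form
`F_c = ∑ σ, c σ · x_σ · Vandermonde (x_v : v ∈ σ)` of degree `t`, an alternation of the staircase
monomial `x_0 x_1² ⋯ x_{D-1}^D`. Contraction by `e_k` lowers the exponents in a `k`-subset of the
staircase by one; unless this subset is an initial segment, two exponents become equal and the
alternation vanishes. Lowering an initial segment frees one vertex, and summing over it turns `c`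
into `∂c`. Hence `e_k ∘ F_c` is an alternation along `∂c`, and `F_c` is a stress if `c` is a cycle.

Conversely, let `F` be a stress of degree `t`. For `|σ| = D` the form `x_σ ∘ F` is killed by the
variables outside `σ` and by `e_1, …, e_D`, so it lies in the inverse system of the coinvariant
algebra of the symmetric group of `σ`; in this degree the latter is a line, on which one coefficient
detects everything. Reading off this coefficient for each `σ` gives a chain `c` with
`x_σ ∘ F = x_σ ∘ F_c`. Since `e_D` is the sum of the `x_σ`, also `F_{∂c} = e_D ∘ F_c = e_D ∘ F = 0`,
so `c` is a cycle. For `|σ| < D` the degree of `x_σ ∘ (F - F_c)` exceeds the top degree of the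
coinvariant algebra of `σ`, so descending induction on `|σ|` yields `F = F_c`.
-/

open MvPolynomial Finset

section Contraction

variable {K V : Type*} [Field K]

theorem contraction_monomial_monomial (a b : V →₀ ℕ) [Decidable (a ≤ b)] :
    contraction K V (monomial a 1) (monomial b 1) =
      if a ≤ b then monomial (b - a) (1 : K) else 0 := by
  have monomial_eq (c : V →₀ ℕ) : monomial c (1 : K) = basisMonomials V K c := by simp
  rw [monomial_eq a, contraction, Module.Basis.constr_basis, monomial_eq b,
    Module.Basis.constr_basis]
  congr

theorem coeff_contraction_monomial (a b : V →₀ ℕ) (F : MvPolynomial V K) :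
    coeff b (contraction K V (monomial a 1) F) = coeff (a + b) F := by
  classical
  induction F using MvPolynomial.induction_on' with
  | monomial c r =>
    rw [← mul_one r, ← smul_eq_mul, ← smul_monomial, map_smul, coeff_smul, coeff_smul,
      contraction_monomial_monomial]
    congr 1
    split_ifs with h
    · rw [coeff_monomial, coeff_monomial]
      refine if_congr ?_ rfl rfl
      rw [tsub_eq_iff_eq_add_of_le h, add_comm]
    · rw [coeff_monomial, if_neg fun hc : c = a + b => h (hc ▸ le_self_add), coeff_zero]
  | add p q hp hq => rw [map_add, coeff_add, coeff_add, hp, hq]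

theorem contraction_mul (p q F : MvPolynomial V K) :
    contraction K V (p * q) F = contraction K V p (contraction K V q F) := by
  induction p using MvPolynomial.induction_on' with
  | add p₁ p₂ h₁ h₂ => simp only [add_mul, map_add, LinearMap.add_apply, h₁, h₂]
  | monomial a r =>
    induction q using MvPolynomial.induction_on' with
    | add q₁ q₂ h₁ h₂ => simp only [mul_add, map_add, LinearMap.add_apply, h₁, h₂]
    | monomial b s =>
      have monomial_eq (c : V →₀ ℕ) (t : K) : monomial c t = t • monomial c 1 := by
        simp [smul_monomial]
      rw [monomial_mul, monomial_eq (a + b), monomial_eq a, monomial_eq b]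
      ext c
      simp only [map_smul, LinearMap.smul_apply, coeff_smul, coeff_contraction_monomial,
        smul_eq_mul, mul_assoc, mul_left_comm s r, add_assoc, add_left_comm b a]

theorem contraction_one (F : MvPolynomial V K) : contraction K V 1 F = F := by
  ext b
  rw [one_def, coeff_contraction_monomial, zero_add]

theorem isHomogeneous_contraction_monomial {F : MvPolynomial V K} {N : ℕ}
    (hF : F.IsHomogeneous N) (a : V →₀ ℕ) :
    (contraction K V (monomial a 1) F).IsHomogeneous (N - a.degree) := by
  intro b hb
  rw [coeff_contraction_monomial] at hb
  have hdeg := hF hb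
  rw [map_add] at hdeg
  rw [Finsupp.degree_eq_weight_one]
  exact Nat.eq_sub_of_add_eq' hdeg

/-- The annihilator of a form `F` for the contraction action: the ideal of all `g` with
`g ∘ F = 0`. -/
noncomputable def contractionAnnihilator (F : MvPolynomial V K) : Ideal (MvPolynomial V K) where
  carrier := {g | contraction K V g F = 0}
  add_mem' {g h} (hg : contraction K V g F = 0) (hh : contraction K V h F = 0) := by
    rw [Set.mem_ofPred_eq, map_add, LinearMap.add_apply, hg, hh, add_zero]
  zero_mem' := by simp
  smul_mem' g h (hh : contraction K V h F = 0) := by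
    rw [Set.mem_ofPred_eq, smul_eq_mul, contraction_mul, hh, map_zero]

theorem mem_contractionAnnihilator {F g : MvPolynomial V K} :
    g ∈ contractionAnnihilator F ↔ contraction K V g F = 0 :=
  Iff.rfl

theorem contractionAnnihilator_le_contraction (q F : MvPolynomial V K) :
    contractionAnnihilator F ≤ contractionAnnihilator (contraction K V q F) := by
  intro g hg
  rw [mem_contractionAnnihilator, ← contraction_mul]
  exact Ideal.mul_mem_right q _ hg

theorem mem_inverseSystem_iff_le {I : Ideal (MvPolynomial V K)} {F : MvPolynomial V K} :
    F ∈ inverseSystem I ↔ I ≤ contractionAnnihilator F :=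
  Iff.rfl

theorem contraction_rename_monomial {W : Type*} {w : W → V} (hw : Function.Injective w)
    (a : W →₀ ℕ) (p : MvPolynomial W K) :
    contraction K V (rename w (monomial a 1)) (rename w p) =
      rename w (contraction K W (monomial a 1) p) := by
  classical
  induction p using MvPolynomial.induction_on' with
  | add p q hp hq => simp only [map_add, hp, hq]
  | monomial b r =>
    rw [← mul_one r, ← smul_eq_mul, ← smul_monomial]
    simp only [map_smul, rename_monomial, contraction_monomial_monomial,
      Finsupp.mapDomain_le_mapDomain_iff_le hw]
    split_ifs
    · rw [rename_monomial, Finsupp.mapDomain_tsub hw]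
    · rw [map_zero]

theorem contraction_X_rename_of_notMem_range {W : Type*} {w : W → V} {v : V}
    (hv : v ∉ Set.range w) (p : MvPolynomial W K) :
    contraction K V (X v) (rename w p) = 0 := by
  ext b
  rw [X, coeff_contraction_monomial, coeff_zero]
  refine coeff_rename_eq_zero _ _ _ fun a ha => ?_
  have := DFunLike.congr_fun ha v
  rw [Finsupp.mapDomain_of_notMem_range _ _ hv, Finsupp.add_apply, Finsupp.single_eq_same] at this
  omega

theorem contraction_prod_X_rename_eq_zero {W : Type*} {w : W → V} {τ : Finset V}
    (hτ : ¬ (τ : Set V) ⊆ Set.range w) (p : MvPolynomial W K) :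
    contraction K V (∏ v ∈ τ, X v) (rename w p) = 0 := by
  obtain ⟨v, hvτ, hv⟩ := Set.not_subset.1 hτ
  exact Ideal.mem_of_dvd (contractionAnnihilator (rename w p)) (dvd_prod_of_mem _ hvτ)
    (contraction_X_rename_of_notMem_range hv p)

end Contraction

section ElementarySymmetric

/-- The exponent vector of the squarefree monomial `∏ v ∈ A, x_v`. -/
noncomputable def squarefreeExponent {V : Type*} (A : Finset V) : V →₀ ℕ :=
  ∑ v ∈ A, Finsupp.single v 1

theorem squarefreeExponent_apply {V : Type*} [DecidableEq V] (A : Finset V) (v : V) :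
    squarefreeExponent A v = if v ∈ A then 1 else 0 := by
  simp [squarefreeExponent, Finsupp.single_apply]

theorem degree_squarefreeExponent {V : Type*} (A : Finset V) :
    (squarefreeExponent A).degree = #A := by
  simp [squarefreeExponent]

theorem squarefreeExponent_le {V : Type*} {A : Finset V} {a : V →₀ ℕ} (h : A ⊆ a.support) :
    squarefreeExponent A ≤ a := by
  classical
  intro v
  rw [squarefreeExponent_apply]
  split_ifs with hv
  · exact Nat.one_le_iff_ne_zero.2 (Finsupp.mem_support_iff.1 (h hv))
  · exact Nat.zero_le _

variable {R V : Type*} [CommRing R]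

theorem prod_X_eq_monomial (A : Finset V) :
    ∏ v ∈ A, (X v : MvPolynomial V R) = monomial (squarefreeExponent A) 1 :=
  (monomial_sum_one A fun v => Finsupp.single v 1).symm

theorem rename_prod_X {W : Type*} (w : W ↪ V) (A : Finset W) :
    rename w (∏ i ∈ A, X i : MvPolynomial W R) = ∏ v ∈ A.map w, X v := by
  simp

variable [Fintype V] {I : Ideal (MvPolynomial V R)} {s : Finset V}

theorem esymm_sub_sum_prod_X_mem (hX : ∀ v ∉ s, X v ∈ I) (k : ℕ) :
    esymm V R k - ∑ A ∈ powersetCard k s, ∏ v ∈ A, (X v : MvPolynomial V R) ∈ I := by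
  classical
  rw [esymm, ← sum_sdiff_eq_sub (powersetCard_mono (subset_univ s))]
  refine I.sum_mem fun A hA => ?_
  rw [mem_sdiff, mem_powersetCard, mem_powersetCard] at hA
  obtain ⟨v, hvA, hvs⟩ := not_subset.1 fun h => hA.2 ⟨h, hA.1.2⟩
  exact I.mem_of_dvd (dvd_prod_of_mem _ hvA) (hX v hvs)

theorem X_pow_card_mem (hX : ∀ v ∉ s, X v ∈ I)
    (he : ∀ k, 1 ≤ k → k ≤ #s → esymm V R k ∈ I) {v : V} (hv : v ∈ s) :
    (X v : MvPolynomial V R) ^ #s ∈ I := by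
  -- Evaluate `∏ u ∈ s, (T - x_u) = ∑ j, (-1)^j e_j(s) T^(|s| - j)` at the root `T = x_v`.
  have vieta := congrArg (Polynomial.eval (X v))
    (Multiset.prod_X_sub_X_eq_sum_esymm (s.val.map (X : V → MvPolynomial V R)))
  have root : Polynomial.eval (X v) ((s.val.map (X : V → MvPolynomial V R)).map
      fun t => Polynomial.X - Polynomial.C t).prod = 0 := by
    rw [Multiset.map_map, ← Finset.prod_eq_multiset_prod, Polynomial.eval_prod]
    exact prod_eq_zero hv (by simp)
  rw [root, Polynomial.eval_finsetSum, sum_range_succ'] at vieta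
  simp only [Multiset.card_map, card_val, esymm_map_val, Polynomial.eval_mul, Polynomial.eval_pow,
    Polynomial.eval_neg, Polynomial.eval_one, Polynomial.eval_C, Polynomial.eval_X, pow_zero,
    powersetCard_zero, sum_singleton, prod_empty, one_mul, Nat.sub_zero] at vieta
  rw [eq_neg_of_add_eq_zero_right vieta.symm]
  refine I.neg_mem (I.sum_mem fun j hj => I.mul_mem_left _ (I.mul_mem_right _ ?_))
  simpa only [sub_sub_cancel] using
    I.sub_mem (he _ (by omega) (mem_range.1 hj)) (esymm_sub_sum_prod_X_mem hX (j + 1))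

end ElementarySymmetric

section Staircase

theorem choose_two_succ (n : ℕ) : (n + 1).choose 2 = n + n.choose 2 := by
  rw [Nat.choose_succ_succ, Nat.choose_one_right]

/-- The exponent vector `(r, r + 1, …, r + n - 1)`. For `r = 0` it is the leading exponent of the
Vandermonde determinant in `n` variables, for `r = 1` the one of the determinant times the product
of the variables. -/
noncomputable def staircase (r n : ℕ) : Fin n →₀ ℕ :=
  Finsupp.equivFunOnFinite.symm fun j => r + j

theorem staircase_apply (r : ℕ) {n : ℕ} (j : Fin n) : staircase r n j = r + j :=
  rfl

theorem degree_staircase (r n : ℕ) : (staircase r n).degree = n * r + n.choose 2 := by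
  simp only [Finsupp.degree_eq_sum, staircase_apply, sum_add_distrib, sum_const, card_univ,
    Fintype.card_fin, smul_eq_mul]
  rw [Fin.sum_univ_eq_sum_range (fun j => j), sum_range_id, Nat.choose_two_right]

theorem degree_staircase_one (n : ℕ) : (staircase 1 n).degree = (n + 1).choose 2 := by
  rw [degree_staircase, mul_one, choose_two_succ]

theorem staircase_one (n : ℕ) : staircase 1 n = squarefreeExponent univ + staircase 0 n := by
  ext j
  rw [Finsupp.add_apply, squarefreeExponent_apply, if_pos (mem_univ j), staircase_apply,
    staircase_apply, zero_add]

theorem mapDomain_staircase_succ {V : Type*} (r : ℕ) {n : ℕ} (w : Fin (n + 1) → V) :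
    (staircase r (n + 1)).mapDomain w =
      (staircase r n).mapDomain (w ∘ Fin.castSucc) + Finsupp.single (w (Fin.last n)) (r + n) := by
  have expand {m : ℕ} (u : Fin m → V) :
      (staircase r m).mapDomain u = ∑ j, Finsupp.single (u j) (r + (j : ℕ)) :=
    Finsupp.sum_fintype _ _ fun _ => Finsupp.single_zero _
  simp only [expand, Fin.sum_univ_castSucc, Function.comp_apply, Fin.val_castSucc, Fin.val_last]

variable {V : Type*} [LinearOrder V]

/-- The exponent vector of `v₁ v₂² ⋯ vₘᵐ` for `σ = {v₁ < ⋯ < vₘ}`: the monomial from which the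
coefficient of `σ` in the top-dimensional cycle of a stress is read off. -/
noncomputable def standardExponent (σ : Finset V) : V →₀ ℕ :=
  (staircase 1 #σ).mapDomain (σ.orderEmbOfFin rfl)

theorem standardExponent_eq (σ : Finset V) :
    standardExponent σ =
      squarefreeExponent σ + (staircase 0 #σ).mapDomain (σ.orderEmbOfFin rfl) := by
  rw [standardExponent, staircase_one, Finsupp.mapDomain_add]
  congr 1
  rw [squarefreeExponent, Finsupp.mapDomain_finsetSum]
  simp only [Finsupp.mapDomain_single]
  rw [squarefreeExponent]
  conv_rhs => rw [← map_orderEmbOfFin_univ σ rfl, sum_map]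
  rfl

theorem degree_standardExponent (σ : Finset V) :
    (standardExponent σ).degree = (#σ + 1).choose 2 := by
  rw [standardExponent, Finsupp.degree_mapDomain, degree_staircase_one]

end Staircase

section Uniqueness

variable {K V : Type*} [Field K]

theorem eq_zero_of_forall_contraction_X_eq_zero {F : MvPolynomial V K}
    (hX : ∀ v, contraction K V (X v) F = 0) (h0 : coeff 0 F = 0) : F = 0 := by
  ext b
  rw [coeff_zero]
  rcases eq_or_ne b 0 with rfl | hb
  · exact h0
  · obtain ⟨v, hv⟩ := Finsupp.ne_iff.1 hb
    have hle : Finsupp.single v 1 ≤ b := by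
      rw [Finsupp.single_le_iff]
      exact Nat.one_le_iff_ne_zero.2 hv
    rw [← add_tsub_cancel_of_le hle, ← coeff_contraction_monomial]
    exact congrArg (coeff _) (hX v)

variable [Fintype V]

theorem eq_zero_of_coeff_staircase {n N : ℕ} {w : Fin n → V} (hw : Function.Injective w)
    {F : MvPolynomial V K} (hF : F.IsHomogeneous N) (hN : n.choose 2 ≤ N)
    (hX : ∀ v ∉ Set.range w, X v ∈ contractionAnnihilator F)
    (he : ∀ k, 1 ≤ k → k ≤ n → esymm V K k ∈ contractionAnnihilator F)
    (h0 : coeff ((staircase 0 n).mapDomain w) F = 0) : F = 0 := by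
  induction n generalizing N F with
  | zero =>
    refine eq_zero_of_forall_contraction_X_eq_zero (fun v => hX v fun ⟨j, _⟩ => j.elim0) ?_
    rwa [Subsingleton.elim (staircase 0 0) 0, Finsupp.mapDomain_zero] at h0
  | succ n ih =>
    set v := w (Fin.last n) with hv
    rw [choose_two_succ] at hN
    -- If `x_v ^ (j + 1)` kills `F`, then `x_v ^ j ∘ F` is a form in the remaining variables only.
    have descend (j : ℕ) (hj : j ≤ n) (hsucc : contraction K V (X v ^ (j + 1)) F = 0) :
        contraction K V (X v ^ j) F = 0 := by
      have hAnn := contractionAnnihilator_le_contraction (X v ^ j) F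
      refine ih (N := N - j) (hw.comp (Fin.castSucc_injective n)) ?_ (by omega) (fun u hu => ?_)
        (fun k h1 hk => hAnn (he k h1 (by omega))) ?_
      · simpa only [X_pow_eq_monomial, Finsupp.degree_single] using
          isHomogeneous_contraction_monomial hF (Finsupp.single v j)
      · rcases eq_or_ne u v with rfl | huv
        · rwa [mem_contractionAnnihilator, ← contraction_mul, ← pow_succ']
        · refine hAnn (hX u ?_)
          rintro ⟨i, rfl⟩
          exact i.lastCases (fun h _ => h rfl) (fun i _ h => h ⟨i, rfl⟩) huv hu
      · rw [X_pow_eq_monomial, coeff_contraction_monomial, add_comm]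
        rcases hj.eq_or_lt with rfl | hlt
        · rwa [mapDomain_staircase_succ, zero_add] at h0
        · refine hF.coeff_eq_zero (ne_of_lt ?_)
          rw [map_add, Finsupp.degree_mapDomain, degree_staircase, Finsupp.degree_single]
          omega
    have top : contraction K V (X v ^ (n + 1)) F = 0 := by
      have := X_pow_card_mem (I := contractionAnnihilator F) (s := univ.map ⟨w, hw⟩)
        (by simpa using hX) (by simpa using he) (v := v) (by simp [hv])
      rwa [card_map, card_fin] at this
    rw [← contraction_one F, ← pow_zero (X v)]
    exact Nat.decreasingInduction (motive := fun j _ => contraction K V (X v ^ j) F = 0)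
      (fun j hj => descend j (Nat.lt_succ_iff.1 hj)) top (Nat.zero_le _)

variable [LinearOrder V]

/-- Contraction by `∏ σ` moves the question to a form in the variables of `σ` alone. -/
theorem contraction_prod_X_eq_zero {σ : Finset V} {N : ℕ} {G : MvPolynomial V K}
    (hG : G.IsHomogeneous N) (hN : (#σ + 1).choose 2 ≤ N)
    (hX : ∀ v ∉ σ, contraction K V (∏ u ∈ insert v σ, X u) G = 0)
    (he : ∀ k, 1 ≤ k → k ≤ #σ →
      contraction K V (∏ u ∈ σ, X u) (contraction K V (esymm V K k) G) = 0)
    (h0 : coeff (standardExponent σ) G = 0) :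
    contraction K V (∏ u ∈ σ, X u) G = 0 := by
  refine eq_zero_of_coeff_staircase (N := N - #σ) (w := σ.orderEmbOfFin rfl)
    (σ.orderEmbOfFin rfl).injective ?_ ?_ (fun v hv => ?_) (fun k h1 hk => ?_) ?_
  · rw [prod_X_eq_monomial]
    simpa only [degree_squarefreeExponent] using
      isHomogeneous_contraction_monomial hG (squarefreeExponent σ)
  · rw [choose_two_succ] at hN
    omega
  · have hvσ : v ∉ σ := by rwa [range_orderEmbOfFin, mem_coe] at hv
    rw [mem_contractionAnnihilator, ← contraction_mul, ← prod_insert hvσ]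
    exact hX v hvσ
  · rw [mem_contractionAnnihilator, ← contraction_mul, mul_comm, contraction_mul]
    exact he k h1 hk
  · rwa [prod_X_eq_monomial, coeff_contraction_monomial, ← standardExponent_eq]

end Uniqueness

section Orientation

variable (R : Type*) [CommRing R] {V : Type*} [LinearOrder V] {n : ℕ}

/-- The sign of the pair `(a, b)`: `1`, `0`, `-1` according to whether `a < b`, `a = b`, `a > b`. -/
def orderSign (a b : V) : R :=
  if a < b then 1 else if b < a then -1 else 0

theorem orderSign_antisymm (a b : V) : orderSign R a b = -orderSign R b a := by
  unfold orderSign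
  rcases lt_trichotomy a b with h | rfl | h
  · simp [h, h.not_gt]
  · simp
  · simp [h, h.not_gt]

theorem orderSign_self (a : V) : orderSign R a a = 0 := by
  simp [orderSign]

/-- The sign of the ordering `w` of the set `range w`, and `0` if `w` is not injective. -/
def orientation (w : Fin n → V) : R :=
  ∏ i, ∏ j ∈ Ioi i, orderSign R (w i) (w j)

theorem orientation_cons (v : V) (w : Fin n → V) :
    orientation R (Fin.cons v w : Fin (n + 1) → V) =
      (∏ j, orderSign R v (w j)) * orientation R w := by
  simp only [orientation, Fin.prod_univ_succ, Fin.prod_Ioi_succ, Fin.prod_Ioi_zero, Fin.cons_zero,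
    Fin.cons_succ]

theorem orientation_comp_perm (w : Fin n → V) (π : Equiv.Perm (Fin n)) :
    orientation R (w ∘ π) = (Equiv.Perm.sign π : ℤ) * orientation R w :=
  π.prod_Ioi_comp_eq_sign_mul_prod (f := fun i j => orderSign R (w i) (w j))
    fun _ _ => orderSign_antisymm R _ _

theorem orientation_eq_zero {w : Fin n → V} (hw : ¬ Function.Injective w) :
    orientation R w = 0 := by
  obtain ⟨i, j, h, hne⟩ := Function.not_injective_iff.1 hw
  wlog hij : i < j generalizing i j
  · exact this j i h.symm hne.symm (hne.lt_or_gt.resolve_left hij)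
  · exact prod_eq_zero (mem_univ i) (prod_eq_zero (mem_Ioi.2 hij) (by rw [h, orderSign_self]))

theorem orientation_strictMono {w : Fin n → V} (hw : StrictMono w) : orientation R w = 1 :=
  prod_eq_one fun _ _ => prod_eq_one fun _ hj => if_pos (hw (mem_Ioi.1 hj))

theorem prod_orderSign {w : Fin n → V} (hw : Function.Injective w) {v : V}
    (hv : v ∉ univ.image w) :
    ∏ j, orderSign R v (w j) = (-1) ^ #{u ∈ univ.image w | u < v} := by
  rw [← prod_image (f := orderSign R v) hw.injOn, ← prod_const, prod_filter]
  refine prod_congr rfl fun u hu => ?_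
  rcases lt_or_gt_of_ne (show v ≠ u from fun h => hv (h ▸ hu)) with h | h
  · simp [orderSign, h, h.not_gt]
  · simp [orderSign, h, h.not_gt]

variable {R}

/-- The coefficient of a chain `c` at the oriented simplex `[w 0, …, w (n - 1)]`: an alternating
function of `w` that agrees with `c` on increasing `w`. -/
def orientedCoeff (w : Fin n → V) : (Finset V → R) →ₗ[R] R :=
  orientation R w • LinearMap.proj (univ.image w)

theorem orientedCoeff_apply (w : Fin n → V) (c : Finset V → R) :
    orientedCoeff w c = orientation R w * c (univ.image w) :=
  rfl

theorem orientedCoeff_eq_zero {w : Fin n → V} (hw : ¬ Function.Injective w) (c : Finset V → R) :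
    orientedCoeff w c = 0 := by
  rw [orientedCoeff_apply, orientation_eq_zero R hw, zero_mul]

theorem orientedCoeff_orderEmbOfFin (σ : Finset V) (c : Finset V → R) :
    orientedCoeff (σ.orderEmbOfFin rfl) c = c σ := by
  have himage : univ.image (σ.orderEmbOfFin rfl) = σ := by
    rw [← coe_inj, coe_image, coe_univ, Set.image_univ, range_orderEmbOfFin]
  rw [orientedCoeff_apply, orientation_strictMono R (σ.orderEmbOfFin rfl).strictMono, one_mul,
    himage]

theorem orientedCoeff_comp_swap (w : Fin n → V) {i j : Fin n} (hij : i ≠ j) (c : Finset V → R) :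
    orientedCoeff (w ∘ Equiv.swap i j) c = -orientedCoeff w c := by
  rw [orientedCoeff_apply, orientedCoeff_apply, orientation_comp_perm, Equiv.Perm.sign_swap hij,
    ← image_image, image_univ_equiv]
  simp

end Orientation

section Boundary

open PreAbstractSimplicialComplex (boundary)

variable {K V : Type*} [Field K] [Fintype V] [LinearOrder V]

theorem boundary_apply (c : Finset V → K) (τ : Finset V) :
    boundary K c τ = ∑ v ∈ univ \ τ, (-1) ^ #{u ∈ τ | u < v} * c (insert v τ) := by
  have expand : boundary K c τ = ∑ v, ∑ σ : Finset V with v ∈ σ,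
      if σ.erase v = τ then (-1) ^ #{u ∈ σ | u < v} * c σ else 0 := by
    rw [boundary, Fintype.linearCombination_apply, Finset.sum_apply,
      sum_comm' (t' := univ) (s' := fun σ : Finset V => σ) (by simp)]
    refine sum_congr rfl fun σ _ => ?_
    rw [Pi.smul_apply, Finset.sum_apply, smul_eq_mul, mul_sum]
    refine sum_congr rfl fun v _ => ?_
    rw [Pi.single_apply, mul_ite, mul_zero, mul_comm]
    exact if_congr eq_comm rfl rfl
  rw [expand, ← sum_subset (subset_univ (univ \ τ))]
  · refine sum_congr rfl fun v hv => ?_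
    have hvτ : v ∉ τ := (mem_sdiff.1 hv).2
    rw [sum_eq_single_of_mem (insert v τ) (by simp)]
    · rw [erase_insert hvτ, if_pos rfl, filter_insert, if_neg (lt_irrefl v)]
    · intro σ hσ hne
      refine if_neg fun h => hne ?_
      rw [← h, insert_erase (mem_filter.1 hσ).2]
  · intro v _ hv
    have hvτ : v ∈ τ := by simpa using hv
    exact sum_eq_zero fun σ _ => if_neg fun h : σ.erase v = τ => notMem_erase v σ (h ▸ hvτ)

theorem sum_orientedCoeff_cons {n : ℕ} (w : Fin n → V) (c : Finset V → K) :
    ∑ v, orientedCoeff (Fin.cons v w : Fin (n + 1) → V) c = orientedCoeff w (boundary K c) := by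
  by_cases hw : Function.Injective w
  · rw [orientedCoeff_apply, boundary_apply, mul_sum,
      ← sum_subset (subset_univ (univ \ univ.image w))]
    · refine sum_congr rfl fun v hv => ?_
      have himage : univ.image (Fin.cons v w : Fin (n + 1) → V) = insert v (univ.image w) := by
        ext u
        simp [Fin.exists_fin_succ, eq_comm]
      rw [orientedCoeff_apply, orientation_cons, prod_orderSign K hw (mem_sdiff.1 hv).2, himage]
      ring
    · intro v _ hv
      refine orientedCoeff_eq_zero (fun hinj => hv ?_) c
      rw [Fin.cons_injective_iff] at hinj
      simpa using hinj.1
  · rw [orientedCoeff_eq_zero hw]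
    exact sum_eq_zero fun v _ =>
      orientedCoeff_eq_zero (fun hinj => hw (Fin.cons_injective_iff.1 hinj).2) c

end Boundary

section Alternation

variable {R V : Type*} [CommRing R] [Fintype V] [LinearOrder V] {n : ℕ}

/-- The alternation of a polynomial `p` in `n` variables along a chain `c`: the sum of
`c [w 0, …, w (n - 1)] · p (y_{w 0}, …, y_{w (n - 1)})` over all `w : Fin n → V`, with the
coefficients of `orientedCoeff`. -/
noncomputable def alternation (n : ℕ) :
    (Finset V → R) →ₗ[R] MvPolynomial (Fin n) R →ₗ[R] MvPolynomial V R :=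
  ∑ w : Fin n → V, (orientedCoeff w).smulRight (rename w).toLinearMap

theorem alternation_apply (c : Finset V → R) (p : MvPolynomial (Fin n) R) :
    alternation n c p = ∑ w : Fin n → V, orientedCoeff w c • rename w p := by
  simp [alternation]

theorem isHomogeneous_alternation (c : Finset V → R) {p : MvPolynomial (Fin n) R} {N : ℕ}
    (hp : p.IsHomogeneous N) : (alternation n c p).IsHomogeneous N := by
  rw [alternation_apply]
  exact IsHomogeneous.sum _ _ _ fun w _ =>
    (homogeneousSubmodule V R N).smul_mem _ hp.rename_isHomogeneous

theorem alternation_eq_zero_of_rename_swap {p : MvPolynomial (Fin n) R} {i j : Fin n} (hij : i ≠ j)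
    (hp : rename (Equiv.swap i j) p = p) (c : Finset V → R) : alternation n c p = 0 := by
  rw [alternation_apply]
  refine sum_involution (fun w _ => w ∘ Equiv.swap i j) (fun w _ => ?_) (fun w _ hne hw => hne ?_)
    (fun _ _ => mem_univ _) fun w _ => ?_
  · rw [orientedCoeff_comp_swap w hij, ← rename_rename, hp, neg_smul, add_neg_cancel]
  · have heq : w i = w j := by simpa using (congrFun hw i).symm
    rw [orientedCoeff_eq_zero fun hinj => hij (hinj heq), zero_smul]
  · ext k
    simp

theorem alternation_monomial_eq_zero {f : Fin n →₀ ℕ} (hf : ¬ Function.Injective f)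
    (c : Finset V → R) (r : R) : alternation n c (monomial f r) = 0 := by
  obtain ⟨i, j, hfij, hij⟩ := Function.not_injective_iff.1 hf
  refine alternation_eq_zero_of_rename_swap hij ?_ c
  rw [rename_monomial]
  refine congrArg (monomial · r) (Finsupp.ext fun k => ?_)
  rw [Finsupp.mapDomain_equiv_apply, Equiv.symm_swap, Equiv.swap_apply_def]
  split_ifs with hki hkj
  · rw [hki, hfij]
  · rw [hkj, hfij]
  · rfl

theorem coeff_mapDomain_alternation_monomial {f : Fin n →₀ ℕ} (hf : Function.Injective f)
    (hf0 : ∀ i, f i ≠ 0) {w : Fin n → V} (hw : Function.Injective w) (c : Finset V → R) :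
    coeff (f.mapDomain w) (alternation n c (monomial f 1)) = orientedCoeff w c := by
  rw [alternation_apply, coeff_sum, sum_eq_single_of_mem w (mem_univ w)]
  · rw [coeff_smul, coeff_rename_mapDomain w hw, coeff_monomial, if_pos rfl, smul_eq_mul, mul_one]
  · intro w' _ hne
    by_cases hw' : Function.Injective w'
    · rw [coeff_smul, rename_monomial, coeff_monomial, if_neg, smul_zero]
      refine fun heq => hne (funext fun j => ?_)
      have hvalue := (DFunLike.congr_fun heq (w j)).trans (Finsupp.mapDomain_apply hw f j)
      obtain ⟨i, hi⟩ : w j ∈ Set.range w' := by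
        by_contra hnot
        rw [Finsupp.mapDomain_of_notMem_range _ _ hnot] at hvalue
        exact hf0 j hvalue.symm
      rw [← hi, Finsupp.mapDomain_apply hw'] at hvalue
      rw [← hi, hf hvalue]
    · rw [orientedCoeff_eq_zero hw', zero_smul, coeff_zero]

end Alternation

section AlternationContraction

open PreAbstractSimplicialComplex (boundary)

variable {K V : Type*} [Field K] [Fintype V] {n : ℕ}

theorem contraction_esymm_rename {W : Type*} [Fintype W] {w : W → V} (hw : Function.Injective w)
    (k : ℕ) (p : MvPolynomial W K) :
    contraction K V (esymm V K k) (rename w p) =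
      rename w (contraction K W (esymm W K k) p) := by
  have hmem := esymm_sub_sum_prod_X_mem (I := contractionAnnihilator (rename w p))
    (s := univ.map ⟨w, hw⟩)
    (fun v hv => contraction_X_rename_of_notMem_range (by simpa using hv) p) k
  rw [mem_contractionAnnihilator, map_sub, LinearMap.sub_apply, sub_eq_zero] at hmem
  rw [hmem, powersetCard_map, sum_map, esymm]
  simp only [map_sum, LinearMap.sum_apply]
  refine sum_congr rfl fun A _ => ?_
  rw [prod_X_eq_monomial A, ← contraction_rename_monomial hw, ← prod_X_eq_monomial]
  exact congrArg (contraction K V · _) (rename_prod_X ⟨w, hw⟩ A).symm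

theorem contraction_esymm_monomial {a : V →₀ ℕ} (ha : ∀ v, a v ≠ 0) (k : ℕ) :
    contraction K V (esymm V K k) (monomial a 1) =
      ∑ T ∈ powersetCard k univ, monomial (a - squarefreeExponent T) 1 := by
  classical
  rw [esymm, map_sum, LinearMap.sum_apply]
  refine sum_congr rfl fun T _ => ?_
  rw [prod_X_eq_monomial, contraction_monomial_monomial,
    if_pos (squarefreeExponent_le fun v _ => Finsupp.mem_support_iff.2 (ha v))]

variable [LinearOrder V]

theorem contraction_esymm_alternation (k : ℕ) (c : Finset V → K) (p : MvPolynomial (Fin n) K) :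
    contraction K V (esymm V K k) (alternation n c p) =
      alternation n c (contraction K (Fin n) (esymm (Fin n) K k) p) := by
  simp only [alternation_apply, map_sum, map_smul]
  refine sum_congr rfl fun w _ => ?_
  by_cases hw : Function.Injective w
  · rw [contraction_esymm_rename hw]
  · rw [orientedCoeff_eq_zero hw, zero_smul, zero_smul]

theorem contraction_prod_X_alternation_eq_zero {c : Finset V → K} {τ : Finset V}
    (hc : ∀ σ, τ ⊆ σ → #σ = n → c σ = 0) (p : MvPolynomial (Fin n) K) :
    contraction K V (∏ v ∈ τ, X v) (alternation n c p) = 0 := by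
  simp only [alternation_apply, map_sum, map_smul]
  refine sum_eq_zero fun w _ => ?_
  by_cases hw : Function.Injective w
  · by_cases hτ : (τ : Set V) ⊆ Set.range w
    · have hzero : c (univ.image w) = 0 := by
        refine hc _ (fun v hv => ?_) (by rw [card_image_of_injective _ hw, card_fin])
        simpa using hτ hv
      rw [orientedCoeff_apply, hzero, mul_zero, zero_smul]
    · rw [contraction_prod_X_rename_eq_zero hτ, smul_zero]
  · rw [orientedCoeff_eq_zero hw, zero_smul]

theorem alternation_rename_succ (c : Finset V → K) (p : MvPolynomial (Fin n) K) :
    alternation (n + 1) c (rename Fin.succ p) = alternation n (boundary K c) p := by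
  rw [alternation_apply, alternation_apply, ← (Fin.consEquiv fun _ => V).sum_comp,
    Fintype.sum_prod_type_right]
  refine sum_congr rfl fun w _ => ?_
  rw [← sum_orientedCoeff_cons, sum_smul]
  refine sum_congr rfl fun v _ => ?_
  rw [rename_rename]
  rfl

end AlternationContraction

section StaircaseContraction

variable {n : ℕ}

theorem eq_Iic_of_succ_mem {T : Finset (Fin (n + 1))}
    (hT : ∀ i : Fin n, i.succ ∈ T → i.castSucc ∈ T) {m : Fin (n + 1)} (hcard : #T = m + 1) :
    T = Iic m := by
  have lower (a : Fin (n + 1)) : a ∈ T → ∀ b ≤ a, b ∈ T := by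
    induction a using Fin.induction with
    | zero => exact fun h b hb => Fin.le_zero_iff.1 hb ▸ h
    | succ i ih =>
      intro h b hb
      rcases hb.eq_or_lt with rfl | hlt
      · exact h
      · exact ih (hT i h) b (Fin.le_castSucc_iff.2 hlt)
  have hne : T.Nonempty := card_pos.1 (by omega)
  have hTmax : T = Iic (T.max' hne) := by
    ext b
    exact ⟨fun h => mem_Iic.2 (T.le_max' b h),
      fun h => lower _ (T.max'_mem hne) b (mem_Iic.1 h)⟩
  rw [hTmax, Fin.card_Iic, add_left_inj, Fin.val_inj] at hcard
  rw [hTmax, hcard]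

theorem not_injective_staircase_sub {T : Finset (Fin (n + 1))} {i : Fin n} (hsucc : i.succ ∈ T)
    (hcast : i.castSucc ∉ T) :
    ¬ Function.Injective (staircase 1 (n + 1) - squarefreeExponent T) := by
  intro hinj
  refine (Fin.castSucc_lt_succ (i := i)).ne (hinj ?_)
  simp [Finsupp.tsub_apply, staircase_apply, squarefreeExponent_apply, hsucc, hcast, add_comm]

theorem staircase_sub_Iic (m : Fin (n + 1)) :
    staircase 1 (n + 1) - squarefreeExponent (Iic m) =
      (staircase 1 n + squarefreeExponent {j : Fin n | m ≤ j.castSucc}).mapDomain Fin.succ := by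
  ext j
  refine j.cases ?_ fun j => ?_
  · rw [Finsupp.mapDomain_of_notMem_range _ _ (by simp)]
    simp [Finsupp.tsub_apply, staircase_apply, squarefreeExponent_apply]
  · rw [Finsupp.mapDomain_apply (Fin.succ_injective n)]
    simp only [Finsupp.tsub_apply, Finsupp.add_apply, staircase_apply, squarefreeExponent_apply,
      mem_Iic, mem_filter_univ, Fin.le_def, Fin.val_succ, Fin.val_castSucc]
    split_ifs <;> omega

end StaircaseContraction

section StressOfChain

open PreAbstractSimplicialComplex (boundary)

variable {K V : Type*} [Field K] [Fintype V] [LinearOrder V]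

/-- The form `∑ σ, c σ · x_σ · Vandermonde (x_v : v ∈ σ)`, over the sets `σ` of cardinality `n`, of
a chain `c`: the alternation of `x_0 x_1² ⋯ x_{n-1}ⁿ`. -/
noncomputable def stressOfChain (n : ℕ) : (Finset V → K) →ₗ[K] MvPolynomial V K :=
  (alternation n).flip (monomial (staircase 1 n) 1)

theorem stressOfChain_apply (n : ℕ) (c : Finset V → K) :
    stressOfChain n c = alternation n c (monomial (staircase 1 n) 1) :=
  rfl

theorem isHomogeneous_stressOfChain (n : ℕ) (c : Finset V → K) :
    (stressOfChain n c).IsHomogeneous ((n + 1).choose 2) :=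
  isHomogeneous_alternation c (isHomogeneous_monomial 1 (degree_staircase_one n))

theorem coeff_standardExponent_stressOfChain (σ : Finset V) (c : Finset V → K) :
    coeff (standardExponent σ) (stressOfChain #σ c) = c σ := by
  rw [stressOfChain_apply, standardExponent, coeff_mapDomain_alternation_monomial,
    orientedCoeff_orderEmbOfFin]
  · exact fun i j h => Fin.ext (add_left_cancel h)
  · exact fun i => by rw [staircase_apply]; omega
  · exact (σ.orderEmbOfFin rfl).injective

/-- Only the initial segment `T = Iic m` survives alternation: any other `T` lowers two neighbouring
exponents of the staircase to the same value. -/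
theorem contraction_esymm_stressOfChain {n : ℕ} (m : Fin (n + 1)) (c : Finset V → K) :
    contraction K V (esymm V K (m + 1)) (stressOfChain (n + 1) c) =
      alternation n (boundary K c)
        (monomial (staircase 1 n + squarefreeExponent {j : Fin n | m ≤ j.castSucc}) 1) := by
  rw [stressOfChain_apply, contraction_esymm_alternation,
    contraction_esymm_monomial fun i => by rw [staircase_apply]; omega, map_sum,
    sum_eq_single_of_mem (Iic m) (by simp [mem_powersetCard]),
    staircase_sub_Iic, ← rename_monomial, alternation_rename_succ]
  intro T hT hne
  have hshape : ∃ i : Fin n, i.succ ∈ T ∧ i.castSucc ∉ T := by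
    by_contra! hlower
    exact hne (eq_Iic_of_succ_mem hlower (mem_powersetCard.1 hT).2)
  obtain ⟨i, hsucc, hcast⟩ := hshape
  exact alternation_monomial_eq_zero (not_injective_staircase_sub hsucc hcast) c 1

theorem contraction_esymm_stressOfChain_last (n : ℕ) (c : Finset V → K) :
    contraction K V (esymm V K (n + 1)) (stressOfChain (n + 1) c) =
      stressOfChain n (boundary K c) := by
  have hempty : ({j | Fin.last n ≤ j.castSucc} : Finset (Fin n)) = ∅ := by simp
  have := contraction_esymm_stressOfChain (Fin.last n) c
  rwa [hempty, squarefreeExponent, sum_empty, add_zero] at this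

end StressOfChain

section TopDegreeStress

open PreAbstractSimplicialComplex (boundary)

variable {K V : Type*} [Field K] [Fintype V] [LinearOrder V] {D : ℕ}

theorem contraction_esymm_stressOfChain_eq_zero {c : Finset V → K} (hc : boundary K c = 0)
    {k : ℕ} (h1 : 1 ≤ k) (hk : k ≤ D) :
    contraction K V (esymm V K k) (stressOfChain D c) = 0 := by
  obtain ⟨m, rfl⟩ := Nat.exists_eq_add_of_le' h1
  obtain ⟨n, rfl⟩ := Nat.exists_eq_add_of_le' (h1.trans hk)
  have := contraction_esymm_stressOfChain ⟨m, hk⟩ c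
  rwa [hc, map_zero, LinearMap.zero_apply] at this

theorem eq_zero_of_forall_contraction_prod_X_eq_zero {N : ℕ} {G : MvPolynomial V K}
    (hG : G.IsHomogeneous N) (hN : (D + 1).choose 2 ≤ N)
    (he : ∀ k, 1 ≤ k → k ≤ D → contraction K V (esymm V K k) G = 0)
    (htop : ∀ σ : Finset V, #σ = D → contraction K V (∏ v ∈ σ, X v) G = 0) : G = 0 := by
  have descend (j : ℕ) (hj : j < D)
      (hsucc : ∀ σ : Finset V, #σ = j + 1 → contraction K V (∏ v ∈ σ, X v) G = 0) :
      ∀ σ : Finset V, #σ = j → contraction K V (∏ v ∈ σ, X v) G = 0 := by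
    rintro σ rfl
    have hdegree : (#σ + 1).choose 2 < N := by
      have hle : (#σ + 1).choose 2 ≤ D.choose 2 := Nat.choose_le_choose 2 hj
      rw [choose_two_succ D] at hN
      omega
    refine contraction_prod_X_eq_zero hG hdegree.le
      (fun v hv => hsucc _ (card_insert_of_notMem hv)) (fun k h1 hk => ?_) ?_
    · rw [he k h1 (hk.trans hj.le), map_zero]
    · exact hG.coeff_eq_zero (by rw [degree_standardExponent]; exact hdegree.ne)
  rw [← contraction_one G, ← prod_empty (f := X)]
  exact Nat.decreasingInduction
    (motive := fun j _ => ∀ σ : Finset V, #σ = j → contraction K V (∏ v ∈ σ, X v) G = 0)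
    descend htop (Nat.zero_le D) ∅ card_empty

/-- The chain on the sets of cardinality `D` whose value at `σ` is the coefficient of a form at
`standardExponent σ`; on forms that are stresses it inverts `stressOfChain D`. -/
noncomputable def chainOfStress (D : ℕ) (F : MvPolynomial V K) : Finset V → K :=
  fun σ => if #σ = D then coeff (standardExponent σ) F else 0

theorem chainOfStress_stressOfChain {c : Finset V → K} (hc : ∀ σ, c σ ≠ 0 → #σ = D) :
    chainOfStress D (stressOfChain D c) = c := by
  ext σ
  rw [chainOfStress]
  split_ifs with hσ
  · rw [← hσ, coeff_standardExponent_stressOfChain]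
  · exact (not_ne_iff.1 fun hne => hσ (hc σ hne)).symm

variable {F : MvPolynomial V K}

theorem contraction_prod_X_sub_stressOfChain_eq_zero (hF : F.IsHomogeneous ((D + 1).choose 2))
    (hX : ∀ τ : Finset V, D < #τ → contraction K V (∏ v ∈ τ, X v) F = 0)
    (he : ∀ k, 1 ≤ k → k ≤ D → contraction K V (esymm V K k) F = 0)
    {σ : Finset V} (hσ : #σ = D) :
    contraction K V (∏ v ∈ σ, X v) (F - stressOfChain D (chainOfStress D F)) = 0 := by
  have no_simplex {n : ℕ} {τ : Finset V} (hn : n < #τ) (c : Finset V → K)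
      (p : MvPolynomial (Fin n) K) : contraction K V (∏ v ∈ τ, X v) (alternation n c p) = 0 :=
    contraction_prod_X_alternation_eq_zero
      (fun _ hτρ hρ => absurd (card_le_card hτρ) (by omega)) p
  refine contraction_prod_X_eq_zero (hF.sub (isHomogeneous_stressOfChain D _)) (by rw [hσ])
    (fun v hv => ?_) (fun k h1 hk => ?_) ?_
  · have hcard : D < #(insert v σ) := by rw [card_insert_of_notMem hv]; omega
    rw [map_sub, hX _ hcard, stressOfChain_apply, no_simplex hcard, sub_zero]
  · rw [hσ] at hk
    obtain ⟨m, rfl⟩ := Nat.exists_eq_add_of_le' h1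
    obtain ⟨n, rfl⟩ := Nat.exists_eq_add_of_le' (h1.trans hk)
    have hesymm := contraction_esymm_stressOfChain ⟨m, hk⟩ (chainOfStress (n + 1) F)
    rw [map_sub, he _ h1 hk, hesymm, zero_sub, map_neg, no_simplex (by omega), neg_zero]
  · rw [coeff_sub, ← hσ, coeff_standardExponent_stressOfChain, chainOfStress, if_pos rfl, sub_self]

theorem boundary_chainOfStress (hF : F.IsHomogeneous ((D + 1).choose 2))
    (hX : ∀ τ : Finset V, D < #τ → contraction K V (∏ v ∈ τ, X v) F = 0)
    (he : ∀ k, 1 ≤ k → k ≤ D → contraction K V (esymm V K k) F = 0) :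
    boundary K (chainOfStress D F) = 0 := by
  ext τ
  by_cases hτ : #τ + 1 = D
  · subst hτ
    have hsub : contraction K V (esymm V K (#τ + 1))
        (F - stressOfChain (#τ + 1) (chainOfStress (#τ + 1) F)) = 0 := by
      rw [esymm, map_sum, LinearMap.sum_apply]
      exact sum_eq_zero fun A hA =>
        contraction_prod_X_sub_stressOfChain_eq_zero hF hX he (mem_powersetCard.1 hA).2
    rw [map_sub, he _ (Nat.le_add_left 1 _) le_rfl, zero_sub, neg_eq_zero,
      contraction_esymm_stressOfChain_last] at hsub
    rw [← coeff_standardExponent_stressOfChain τ (boundary K _), hsub, coeff_zero, Pi.zero_apply]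
  · rw [boundary_apply]
    refine sum_eq_zero fun v hv => ?_
    rw [chainOfStress, card_insert_of_notMem (mem_sdiff.1 hv).2, if_neg hτ, mul_zero]

theorem stressOfChain_chainOfStress (hF : F.IsHomogeneous ((D + 1).choose 2))
    (hX : ∀ τ : Finset V, D < #τ → contraction K V (∏ v ∈ τ, X v) F = 0)
    (he : ∀ k, 1 ≤ k → k ≤ D → contraction K V (esymm V K k) F = 0) :
    stressOfChain D (chainOfStress D F) = F := by
  refine (sub_eq_zero.1 (eq_zero_of_forall_contraction_prod_X_eq_zero (D := D)
    (hF.sub (isHomogeneous_stressOfChain D _)) le_rfl (fun k h1 hk => ?_) fun σ hσ =>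
    contraction_prod_X_sub_stressOfChain_eq_zero hF hX he hσ)).symm
  rw [map_sub, he k h1 hk,
    contraction_esymm_stressOfChain_eq_zero (boundary_chainOfStress hF hX he) h1 hk, sub_zero]

end TopDegreeStress

section CoinvariantStresses

open PreAbstractSimplicialComplex

variable {K V : Type*} [Field K]

theorem isFace_mono {Δ : PreAbstractSimplicialComplex V} {σ τ : Finset V} (hσ : Δ.IsFace σ)
    (h : τ ⊆ σ) : Δ.IsFace τ := by
  rcases τ.eq_empty_or_nonempty with rfl | hτ
  · exact Or.inl rfl
  rcases hσ with rfl | hσ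
  · exact absurd (subset_empty.1 h) hτ.ne_empty
  · exact Or.inr ((Δ.isRelLowerSet_faces hσ).2 h hτ)

variable [Fintype V] (Δ : PreAbstractSimplicialComplex V)

open Classical in
/-- The maximal number of vertices of a face, i.e. `dim Δ + 1` as a natural number. -/
noncomputable def maxFaceCard : ℕ :=
  ({σ | Δ.IsFace σ} : Finset (Finset V)).sup card

theorem dim_eq_maxFaceCard_sub_one : Δ.dim = (maxFaceCard Δ : ℤ) - 1 :=
  rfl

variable {Δ}

theorem card_le_maxFaceCard {σ : Finset V} (hσ : Δ.IsFace σ) : #σ ≤ maxFaceCard Δ := by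
  classical
  exact le_sup (f := card) (mem_filter.2 ⟨mem_univ _, hσ⟩)

theorem mem_coinvariantStresses {k : ℕ} {F : MvPolynomial V K} :
    F ∈ Δ.coinvariantStresses K k ↔
      F.IsHomogeneous k ∧
      (∀ τ, ¬ Δ.IsFace τ → contraction K V (∏ v ∈ τ, X v) F = 0) ∧
      ∀ i, 1 ≤ i → i ≤ maxFaceCard Δ → contraction K V (esymm V K i) F = 0 := by
  rw [coinvariantStresses, inverseSystemDegree, Submodule.mem_inf, mem_inverseSystem_iff_le,
    coinvariantIdeal, sup_le_iff, stanleyReisnerIdeal, Ideal.span_le, Ideal.span_le,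
    mem_homogeneousSubmodule, and_comm]
  refine and_congr_right' (and_congr ⟨fun h τ hτ => h ⟨τ, hτ, rfl⟩, ?_⟩
    ⟨fun h i hi hD => h ⟨i, hi, by rw [dim_eq_maxFaceCard_sub_one]; omega, rfl⟩, ?_⟩)
  · rintro h _ ⟨τ, hτ, rfl⟩
    exact h τ hτ
  · rintro h _ ⟨i, hi, hD, rfl⟩
    rw [dim_eq_maxFaceCard_sub_one] at hD
    exact h i hi (by omega)

variable [LinearOrder V]

theorem mem_cycles_dim {c : Finset V → K} : c ∈ Δ.cycles K Δ.dim ↔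
    (∀ σ, c σ ≠ 0 → Δ.IsFace σ ∧ #σ = maxFaceCard Δ) ∧ boundary K c = 0 := by
  have hcard (σ : Finset V) : (#σ : ℤ) - 1 = Δ.dim ↔ #σ = maxFaceCard Δ := by
    rw [dim_eq_maxFaceCard_sub_one]
    omega
  simp only [← hcard]
  exact Iff.rfl

theorem boundaries_dim_eq_bot : Δ.boundaries K Δ.dim = ⊥ := by
  have hchains : Δ.chains K (Δ.dim + 1) = ⊥ := by
    refine (Submodule.eq_bot_iff _).2 fun c hc => funext fun σ => ?_
    by_contra hσ
    obtain ⟨hface, hcard⟩ := hc σ hσ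
    have := card_le_maxFaceCard hface
    rw [dim_eq_maxFaceCard_sub_one] at hcard
    omega
  rw [boundaries, hchains, Submodule.map_bot]

theorem stressOfChain_mem_coinvariantStresses {c : Finset V → K} (hc : c ∈ Δ.cycles K Δ.dim) :
    stressOfChain (maxFaceCard Δ) c ∈ Δ.coinvariantStresses K ((maxFaceCard Δ + 1).choose 2) := by
  obtain ⟨hface, hboundary⟩ := mem_cycles_dim.1 hc
  refine mem_coinvariantStresses.2 ⟨isHomogeneous_stressOfChain _ c, fun τ hτ => ?_,
    fun i hi hD => contraction_esymm_stressOfChain_eq_zero hboundary hi hD⟩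
  refine contraction_prod_X_alternation_eq_zero (fun σ hτσ _ => ?_) _
  by_contra hσ
  exact hτ (isFace_mono (hface σ hσ).1 hτσ)

theorem exists_cycle_stressOfChain_eq {F : MvPolynomial V K}
    (hF : F ∈ Δ.coinvariantStresses K ((maxFaceCard Δ + 1).choose 2)) :
    ∃ c ∈ Δ.cycles K Δ.dim, stressOfChain (maxFaceCard Δ) c = F := by
  obtain ⟨hhom, hnonface, he⟩ := mem_coinvariantStresses.1 hF
  have hX (τ : Finset V) (hτ : maxFaceCard Δ < #τ) : contraction K V (∏ v ∈ τ, X v) F = 0 :=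
    hnonface τ fun hface => hτ.not_ge (card_le_maxFaceCard hface)
  refine ⟨chainOfStress (maxFaceCard Δ) F,
    mem_cycles_dim.2 ⟨fun σ hσ => ?_, boundary_chainOfStress hhom hX he⟩,
    stressOfChain_chainOfStress hhom hX he⟩
  obtain ⟨hcard, hcoeff⟩ := ite_ne_right_iff.1 hσ
  refine ⟨?_, hcard⟩
  by_contra hface
  rw [standardExponent_eq, ← coeff_contraction_monomial, ← prod_X_eq_monomial, hnonface σ hface,
    coeff_zero] at hcoeff
  exact hcoeff rfl

variable (K Δ)

theorem map_stressOfChain_cycles :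
    (Δ.cycles K Δ.dim).map (stressOfChain (maxFaceCard Δ)) =
      Δ.coinvariantStresses K ((maxFaceCard Δ + 1).choose 2) := by
  refine le_antisymm ?_ fun F hF => exists_cycle_stressOfChain_eq hF
  rintro _ ⟨c, hc, rfl⟩
  exact stressOfChain_mem_coinvariantStresses hc

theorem finrank_coinvariantStresses_eq_finrank_cycles :
    Module.finrank K (Δ.coinvariantStresses K ((maxFaceCard Δ + 1).choose 2)) =
      Module.finrank K (Δ.cycles K Δ.dim) := by
  rw [← map_stressOfChain_cycles, ← LinearMap.range_domRestrict]
  refine LinearMap.finrank_range_of_inj fun c c' h => Subtype.ext ?_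
  have hcard (c : Δ.cycles K Δ.dim) (σ : Finset V) (hσ : c.1 σ ≠ 0) : #σ = maxFaceCard Δ :=
    ((mem_cycles_dim.1 c.2).1 σ hσ).2
  rw [← chainOfStress_stressOfChain (hcard c), ← chainOfStress_stressOfChain (hcard c')]
  exact congrArg (chainOfStress _) h

end CoinvariantStresses

theorem mainTheorem8_general (K : Type*) [Field K] (V : Type*) [Fintype V] [LinearOrder V]
    (Δ : PreAbstractSimplicialComplex V) (d : ℤ) (hd : Δ.dim = d) :
    Module.finrank K (Δ.coinvariantStresses K ((d + 2).toNat.choose 2)) =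
      Module.finrank K (Δ.reducedHomology K d) := by
  subst hd
  have hcard : (Δ.dim + 2).toNat = maxFaceCard Δ + 1 := by
    rw [dim_eq_maxFaceCard_sub_one]
    omega
  have hboundaries : (Δ.boundaries K Δ.dim).submoduleOf (Δ.cycles K Δ.dim) = ⊥ := by
    rw [boundaries_dim_eq_bot, Submodule.submoduleOf, Submodule.comap_bot, Submodule.ker_subtype]
  rw [hcard, finrank_coinvariantStresses_eq_finrank_cycles]
  exact (Submodule.quotEquivOfEqBot _ hboundaries).finrank_eq.symm

theorem mainTheorem8 (K : Type*) [Field K] (V : Type*) [Fintype V] [LinearOrder V]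
    (Δ : PreAbstractSimplicialComplex V) (d : ℤ) (hd : Δ.dim = d) :
    Module.finrank K (Δ.reducedHomology K d) ≤
        Module.finrank K (Δ.coinvariantStresses K ((d + 2).toNat.choose 2)) ∧
      (CharZero K → Δ.IsCohenMacaulay K →
        Module.finrank K (Δ.coinvariantStresses K ((d + 2).toNat.choose 2)) =
          Module.finrank K (Δ.reducedHomology K d)) :=
  ⟨(mainTheorem8_general K V Δ d hd).ge, fun _ _ => mainTheorem8_general K V Δ d hd⟩
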